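/- Let $0<\alpha<1$, $p\in\mathbb{R}$, $b<X$, and let $y:[b,X]\to\mathbb{R}$. For $y\in C^1[b,X]$ let $$y^{(\alpha)}(x)=\frac{1}{\Gamma(1-\alpha)}\int_b^x\frac{y'(\xi)}{(x-\xi)^\alpha}\,d\xi\qquad(b\le x\le X)$$ be the Caputo derivative of $y$ of order $\alpha$ with lower limit $b$. For $h>0$ put $x_n=b+nh$, $y^{(\alpha)}_n=y^{(\alpha)}(x_n)$, and let $$\Delta^\alpha_{h,p}y_n=\Delta^\alpha_{h,p}y(x_n),\qquad \Delta^\alpha_{h,p}y(x)=\sum_{k=0}^{\lfloor (x-b)/h\rfloor}(-1)^k\binom{\alpha}{k}\,y\bigl(x-(k-p)h\bigr),\qquad \binom{\alpha}{k}=\frac{\alpha(\alpha-1)\cdots(\alpha-k+1)}{k!},$$ be the shifted Grünwald difference operator, where $y$ is extended by zero outside $[b,X]$. (i) If $y\in C^4[b,X]$ and $y(b)=y'(b)=y''(b)=0$, then $$h^{-\alpha}\Delta^\alpha_{h,p}y_n=\Bigl(\frac{\alpha}{2}-p\Bigr)y^{(\alpha)}_{n-1}+\Bigl(1+p-\frac{\alpha}{2}\Bigr)y^{(\alpha)}_n+O(h^2).$$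 (ii) If $y\in C^5[b,X]$ and $y(b)=y'(b)=y''(b)=y'''(b)=0$, then $$h^{-\alpha}\Delta^\alpha_{h,p}y_n=\bar\beta_1\,y^{(\alpha)}_{n-2}+\bar\beta_2\,y^{(\alpha)}_{n-1}+\bar\beta_3\,y^{(\alpha)}_n+O(h^3),$$ where $$\bar\beta_1=\frac p2+\frac{p^2}2-\frac{5\alpha}{24}-\frac{p\alpha}2+\frac{\alpha^2}8,\qquad \bar\beta_2=-2p-p^2+\frac{11\alpha}{12}+p\alpha-\frac{\alpha^2}4,$$ $$\bar\beta_3=1+\frac{3p}2+\frac{p^2}2-\frac{17\alpha}{24}-\frac{p\alpha}2+\frac{\alpha^2}8.$$ Here $O(h^m)$ denotes a quantity of absolute value at most $Ch^m$ with a constant $C$ depending only on $\alpha,p,b,X,y$, for all $h>0$ and all integers $n\ge1$ in (i), respectively $n\ge2$ in (ii), with $x_n\le X$ and $x_n+ph\le X$. -/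

import Mathlib

/-- The Caputo derivative of order `α` (`0 < α < 1`) with lower limit `b`, at a point `x ≥ b`:
`y^{(α)}(x) = (1 / Γ(1 - α)) ∫_b^x y'(ξ) / (x - ξ)^α dξ`. -/
noncomputable def caputoDeriv (α b : ℝ) (y : ℝ → ℝ) (x : ℝ) : ℝ :=
  1 / Real.Gamma (1 - α) * ∫ ξ in b..x, deriv y ξ / (x - ξ) ^ α

/-- The generalized binomial coefficient `α (α - 1) ⋯ (α - k + 1) / k!`. -/
noncomputable def fracBinom (α : ℝ) (k : ℕ) : ℝ :=
  (∏ i ∈ Finset.range k, (α - (i : ℝ))) / (Nat.factorial k : ℝ)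

/-- The shifted Grünwald difference operator with lower limit `b`, order `α`, step `h`, shift `p`:
`∑_{k=0}^{⌊(x-b)/h⌋} (-1)^k (α choose k) y(x - (k - p) h)`. -/
noncomputable def shiftedGrunwald (α p b h : ℝ) (y : ℝ → ℝ) (x : ℝ) : ℝ :=
  ∑ k ∈ Finset.range (⌊(x - b) / h⌋₊ + 1),
    (-1 : ℝ) ^ k * fracBinom α k * y (x - ((k : ℝ) - p) * h)

/-- The extension by zero of the restriction of `y` to `[b, X]`. It supplies the values at the
points to the left of `b` that the shifted operator uses when `p < 0`. -/
noncomputable def zeroExtension (b X : ℝ) (y : ℝ → ℝ) : ℝ → ℝ :=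
  (Set.Icc b X).indicator y

/-- The node `x_n = b + n h` of the uniform grid (with `n` an integer index). -/
def gridNode (b h : ℝ) (n : ℤ) : ℝ := b + (n : ℝ) * h

/-! This is a Peano kernel argument. Put r = 2 in (i), r = 3 in (ii), and g = y^(r+1). The vanishing
initial data make y the fractional integral of g of order r + 1, with kernel `powKer r`, and the
Caputo derivative that of order r + 1 - α, with kernel `powKer (r - α)`. With a Grünwald sum long
enough, the error at x is therefore h^(r-α) ∫ E((x-t)/h) g(t) dt, where E(s) = ∑ W_k `powKer r`
(s+p-k) - ∑ β_j `powKer (r - α)` (s-j) and W_k = (-1)^k (α choose k).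

Everything rests on E(s) = O(|s|^(-α)): then the integrand is at most a constant times h^r
|x-t|^(-α), which is integrable since α < 1. The sum in E is evaluated in closed form by binomial
coefficients with a coefficient depending on the fractional part of s+p, and these have
Stirling-type expansions (`binomProd_isBigO`). The β_j make the leading orders cancel: ∑ β_j = 1, ∑
β_j (p+j) = α/2 and, for r = 3, also ∑ β_j (p+j)^2 = α^2/4 + α/12. See `kernel_two_isBigO`,
`kernel_three_isBigO` and, for uniformity in s, `exists_kernel_bound`.

The operator stops at k = n, which may be too early for the kernel identity when p > 0. The missing
terms sample y within |p|h of b, where y = O(h^(r+1)), so they are harmless. -/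

section

open Filter Asymptotics Topology Finset

/-! ### Generalized binomial coefficients and their asymptotic expansion -/

/-- The product `∏_{i=1}^m (1 + a / i)`, i.e. the binomial coefficient `(m + a choose m)`. -/
noncomputable def binomProd (a : ℝ) (m : ℕ) : ℝ := ∏ i ∈ range m, (1 + a / ((i : ℝ) + 1))

lemma binomProd_zero (a : ℝ) : binomProd a 0 = 1 := by simp [binomProd]

lemma binomProd_succ (a : ℝ) (m : ℕ) :
    binomProd a (m + 1) = binomProd a m * (1 + a / ((m : ℝ) + 1)) := by
  simp [binomProd, prod_range_succ]

/-- Pascal's rule. The auxiliary `key` is the absorption identity, which turns both terms on the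
left into multiples of the same product. -/
lemma binomProd_add (a : ℝ) (m : ℕ) :
    binomProd (a + 1) m + binomProd a (m + 1) = binomProd (a + 1) (m + 1) := by
  have key : ∀ m : ℕ, binomProd a (m + 1) = binomProd (a + 1) m * ((a + 1) / ((m : ℝ) + 1)) := by
    intro m
    induction m with
    | zero => simp [binomProd_succ, binomProd_zero, add_comm]
    | succ k ih =>
      rw [binomProd_succ a (k + 1), ih, binomProd_succ (a + 1) k]
      have : (k : ℝ) + 1 ≠ 0 := by positivity
      have h2 : (k : ℝ) + 1 + 1 ≠ 0 := by positivity
      push_cast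
      field_simp
      ring
  rw [key, binomProd_succ]
  ring

/-- Increments of size n^(-4) have tails of size n^(-3). Instead of summing a series, the proof
corrects f by ± 8C n^(-3) to make it monotone and compares with the limit. -/
lemma tendsto_sub_isBigO_pow_three {f : ℕ → ℝ} {L : ℝ} (hf : Tendsto f atTop (𝓝 L))
    (hd : (fun n => f (n + 1) - f n) =O[atTop] fun n : ℕ => ((n : ℝ)⁻¹) ^ 4) :
    (fun n => f n - L) =O[atTop] fun n : ℕ => ((n : ℝ)⁻¹) ^ 3 := by
  obtain ⟨C, hC0, hC⟩ := hd.exists_pos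
  rw [IsBigOWith, eventually_atTop] at hC
  obtain ⟨N, hN⟩ := hC
  have step : ∀ n : ℕ, N + 1 ≤ n →
      |f (n + 1) - f n| ≤ 8 * C * (((n : ℝ)⁻¹) ^ 3 - (((n + 1 : ℕ) : ℝ)⁻¹) ^ 3) := by
    intro n hn
    have h1 := hN n (by omega)
    rw [Real.norm_eq_abs, Real.norm_eq_abs, abs_of_nonneg (by positivity : (0:ℝ) ≤ ((n : ℝ)⁻¹) ^ 4)] at h1
    refine h1.trans ?_
    have hn1 : (1 : ℝ) ≤ n := by exact_mod_cast (by omega : 1 ≤ n)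
    -- The factor 8 is merely convenient: (n+1)^3 ≤ 8 n^3 for n ≥ 1, while (n+1)^3 - n^3 ≥ 3 n^2.
    have : ((n : ℝ)⁻¹) ^ 4 ≤ 8 * (((n : ℝ)⁻¹) ^ 3 - (((n + 1 : ℕ) : ℝ)⁻¹) ^ 3) := by
      push_cast
      have e : 8 * (((n : ℝ)⁻¹) ^ 3 - ((n + 1 : ℝ)⁻¹) ^ 3) - ((n : ℝ)⁻¹) ^ 4
          = (8 * n * ((n + 1) ^ 3 - n ^ 3) - (n + 1) ^ 3) / (n ^ 4 * (n + 1) ^ 3) := by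
        field_simp
      have : 0 ≤ (8 * n * ((n + 1) ^ 3 - n ^ 3) - (n + 1) ^ 3) / ((n : ℝ) ^ 4 * (n + 1) ^ 3) := by
        apply div_nonneg _ (by positivity)
        nlinarith [mul_nonneg (sub_nonneg.2 hn1) (sub_nonneg.2 hn1), pow_pos (by linarith : (0:ℝ) < n) 3]
      linarith
    calc C * ((n : ℝ)⁻¹) ^ 4 ≤ C * _ := mul_le_mul_of_nonneg_left this hC0.le
      _ = _ := by ring
  have hp : Tendsto (fun n : ℕ => 8 * C * ((n : ℝ)⁻¹) ^ 3) atTop (𝓝 0) := by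
    simpa using ((tendsto_inv_atTop_nhds_zero_nat (𝕜 := ℝ)).pow 3).const_mul (8 * C)
  have up : ∀ n ≥ N + 1, L ≤ f n + 8 * C * ((n : ℝ)⁻¹) ^ 3 := by
    intro n hn
    have ha : Antitone fun k : ℕ => f (k + n) + 8 * C * (((k + n : ℕ) : ℝ)⁻¹) ^ 3 := by
      apply antitone_nat_of_succ_le
      intro k
      have := (abs_le.1 (step (k + n) (by omega))).2
      rw [show k + 1 + n = k + n + 1 by ring]
      linarith
    have ht : Tendsto (fun k : ℕ => f (k + n) + 8 * C * (((k + n : ℕ) : ℝ)⁻¹) ^ 3) atTop (𝓝 L) := by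
      simpa [Function.comp_def] using (hf.add hp).comp (tendsto_add_atTop_nat n)
    simpa using ha.le_of_tendsto ht 0
  have lo : ∀ n ≥ N + 1, f n - 8 * C * ((n : ℝ)⁻¹) ^ 3 ≤ L := by
    intro n hn
    have ha : Monotone fun k : ℕ => f (k + n) - 8 * C * (((k + n : ℕ) : ℝ)⁻¹) ^ 3 := by
      apply monotone_nat_of_le_succ
      intro k
      have := (abs_le.1 (step (k + n) (by omega))).1
      rw [show k + 1 + n = k + n + 1 by ring]
      linarith
    have ht : Tendsto (fun k : ℕ => f (k + n) - 8 * C * (((k + n : ℕ) : ℝ)⁻¹) ^ 3) atTop (𝓝 L) := by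
      simpa [Function.comp_def] using (hf.sub hp).comp (tendsto_add_atTop_nat n)
    simpa using ha.ge_of_tendsto ht 0
  refine IsBigO.of_bound (8 * C) (eventually_atTop.2 ⟨N + 1, fun n hn => ?_⟩)
  rw [Real.norm_eq_abs, Real.norm_eq_abs, abs_of_nonneg (by positivity : (0:ℝ) ≤ ((n : ℝ)⁻¹) ^ 3), abs_le]
  constructor <;> linarith [up n hn, lo n hn]

lemma ring_choose_eq_prod (a : ℝ) (n : ℕ) :
    Ring.choose a n = (n.factorial : ℝ)⁻¹ * ∏ j ∈ range n, (a - j) := by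
  rw [Ring.choose_eq_smul, smul_eq_mul]
  congr 1
  induction n with
  | zero => simp
  | succ k ih =>
    rw [descPochhammer_succ_right, Polynomial.smeval_mul, ih, prod_range_succ]
    simp [Polynomial.smeval_sub, Polynomial.smeval_natCast]

lemma one_add_rpow_isBigO_four (a : ℝ) :
    (fun v : ℝ => (1 + v) ^ a - (1 + a * v + a * (a - 1) / 2 * v ^ 2
      + a * (a - 1) * (a - 2) / 6 * v ^ 3)) =O[𝓝 0] fun v => v ^ 4 := by
  have := (Real.one_add_rpow_hasFPowerSeriesAt_zero (a := a)).isBigO_sub_partialSum_pow 4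
  refine (this.congr_left fun v => ?_).trans (isBigO_of_le _ fun v => by simp)
  simp [FormalMultilinearSeries.partialSum, sum_range_succ, ring_choose_eq_prod, prod_range_succ,
    Nat.factorial, - FormalMultilinearSeries.apply_eq_prod_smul_coeff]
  ring

/-- This is Euler's limit formula for Γ(a+1), inverted. `Real.GammaSeq` has one more factor in its
denominator than `binomProd`, and `h2` removes it. -/
lemma tendsto_binomProd (a : ℝ) (ha : -1 < a) :
    Tendsto (fun n : ℕ => Real.Gamma (a + 1) * binomProd a n * (n : ℝ) ^ (-a)) atTop (𝓝 1) := by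
  have hprod : ∀ n : ℕ, ∏ j ∈ range n, (a + 1 + j) = binomProd a n * n.factorial := by
    intro n
    induction n with
    | zero => simp [binomProd_zero]
    | succ k ih =>
      rw [prod_range_succ, ih, binomProd_succ, Nat.factorial_succ]
      push_cast
      field_simp
      ring
  have hG : Real.Gamma (a + 1) ≠ 0 := (Real.Gamma_pos_of_pos (by linarith)).ne'
  have h1 := ((Real.GammaSeq_tendsto_Gamma (a + 1)).inv₀ hG).const_mul (Real.Gamma (a + 1))
  rw [mul_inv_cancel₀ hG] at h1
  have h2 : Tendsto (fun n : ℕ => (1 + (a + 1) * ((n : ℝ))⁻¹)⁻¹) atTop (𝓝 1) := by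
    have := ((tendsto_inv_atTop_nhds_zero_nat (𝕜 := ℝ)).const_mul (a + 1)).const_add 1
    simpa using this.inv₀ (by simp)
  have h3 := h1.mul h2
  rw [one_mul] at h3
  refine h3.congr' ?_
  filter_upwards [eventually_ge_atTop 1] with n hn
  have hn0 : (0 : ℝ) < n := by exact_mod_cast hn
  have hb : 0 < (n : ℝ) + (a + 1) := by linarith
  rw [Real.GammaSeq, prod_range_succ, hprod, Real.rpow_add_one hn0.ne', Real.rpow_neg hn0.le]
  have := (Real.rpow_pos_of_pos hn0 a).ne'
  have := n.factorial_ne_zero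
  have e : 1 + (a + 1) * (n : ℝ)⁻¹ = ((n : ℝ) + (a + 1)) / n := by field_simp
  rw [e]
  field_simp
  ring

/-- Second order Stirling-type expansion of `(m + a choose m)`. -/
lemma binomProd_isBigO (a : ℝ) (ha : -1 < a) :
    (fun n : ℕ => Real.Gamma (a + 1) * binomProd a n * (n : ℝ) ^ (-a)
      - (1 + a * (a + 1) / 2 * (n : ℝ)⁻¹
        + a * (a - 1) * (a + 1) * (3 * a + 2) / 24 * (n : ℝ)⁻¹ ^ 2)) =O[atTop]
      fun n : ℕ => (n : ℝ)⁻¹ ^ 3 := by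
  set p₁ := a * (a + 1) / 2 with hp₁
  set p₂ := a * (a - 1) * (a + 1) * (3 * a + 2) / 24 with hp₂
  set R : ℕ → ℝ := fun n => Real.Gamma (a + 1) * binomProd a n * (n : ℝ) ^ (-a) with hR
  set M : ℝ → ℝ := fun v => 1 + p₁ * v + p₂ * v ^ 2 with hM
  have hv : Tendsto (fun n : ℕ => (n : ℝ)⁻¹) atTop (𝓝 0) := tendsto_inv_atTop_nhds_zero_nat
  have hv' : Tendsto (fun n : ℕ => ((n + 1 : ℕ) : ℝ)⁻¹) atTop (𝓝 0) :=
    hv.comp (tendsto_add_atTop_nat 1)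
  have hMc : Tendsto M (𝓝 0) (𝓝 1) := by
    have : Continuous M := by fun_prop
    simpa [hM] using this.tendsto 0
  have hMn := hMc.comp hv
  have hMn' := hMc.comp hv'
  have hRt : Tendsto R atTop (𝓝 1) := tendsto_binomProd a ha
  have hQ : Tendsto (fun n => R n / M (n : ℝ)⁻¹) atTop (𝓝 1) := by
    simpa using! hRt.div hMn one_ne_zero
  -- With v = 1/n, the increment of R/M is R(n) φ(v) / (M(v) M(v/(1+v)) (1+v)^2). The order v of φ
  -- cancels by itself; p₁ and p₂ are the values that kill the orders v^2 and v^3.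
  set φ : ℝ → ℝ := fun v => (1 + (2 + a) * v + (1 + a) * v ^ 2) * (1 + v) ^ (-a) * M v
      - ((1 + v) ^ 2 + p₁ * v * (1 + v) + p₂ * v ^ 2) with hφ
  have hφO : φ =O[𝓝 0] fun v => v ^ 4 := by
    have h1 := one_add_rpow_isBigO_four (-a)
    have h2 : (fun v : ℝ => (1 + (2 + a) * v + (1 + a) * v ^ 2) * M v) =O[𝓝 0]
        fun _ => (1 : ℝ) := by
      have : Continuous fun v : ℝ => (1 + (2 + a) * v + (1 + a) * v ^ 2) * M v := by fun_prop
      exact (this.tendsto 0).isBigO_one ℝ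
    have h3 := h2.mul h1
    simp only [one_mul] at h3
    set t₁ := -a
    set t₂ := -a * (-a - 1) / 2 with ht₂
    set t₃ := -a * (-a - 1) * (-a - 2) / 6 with ht₃
    -- This is φ with (1+v)^(-a) replaced by its cubic Taylor polynomial, written with the factor
    -- v^4 pulled out.
    have h4 : (fun v : ℝ => v ^ 4 * (((t₃ * p₁ + t₂ * p₂) + (2 + a) * (t₃ + t₂ * p₁ + t₁ * p₂)
          + (1 + a) * (t₂ + t₁ * p₁ + p₂))
        + (t₃ * p₂ + (2 + a) * (t₃ * p₁ + t₂ * p₂) + (1 + a) * (t₃ + t₂ * p₁ + t₁ * p₂)) * v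
        + ((2 + a) * (t₃ * p₂) + (1 + a) * (t₃ * p₁ + t₂ * p₂)) * v ^ 2
        + (1 + a) * (t₃ * p₂) * v ^ 3)) =O[𝓝 0] fun v => v ^ 4 * 1 := by
      refine (isBigO_refl _ _).mul ?_
      refine Tendsto.isBigO_one ℝ (Continuous.tendsto ?_ 0)
      fun_prop
    simp only [mul_one] at h4
    refine (h3.add h4).congr_left fun v => ?_
    simp only [hφ, hM, hp₁, hp₂, ht₂, ht₃, t₁]
    ring
  have hd : (fun n => R (n + 1) / M ((n + 1 : ℕ) : ℝ)⁻¹ - R n / M (n : ℝ)⁻¹) =O[atTop]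
      fun n : ℕ => (n : ℝ)⁻¹ ^ 4 := by
    have h1 : (fun n : ℕ => R n / (M (n : ℝ)⁻¹ * M ((n + 1 : ℕ) : ℝ)⁻¹ * (1 + (n : ℝ)⁻¹) ^ 2))
        =O[atTop] fun _ => (1 : ℝ) := by
      have : Tendsto (fun n : ℕ => (1 + (n : ℝ)⁻¹) ^ 2) atTop (𝓝 1) := by
        simpa using (hv.const_add 1).pow 2
      exact (hRt.div ((hMn.mul hMn').mul this) (by simp)).isBigO_one ℝ
    have h2 := h1.mul (hφO.comp_tendsto hv)
    simp only [one_mul, Function.comp_def] at h2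
    refine h2.congr' ?_ (Eventually.of_forall fun _ => rfl)
    filter_upwards [eventually_ge_atTop 1, hMn.eventually_ne one_ne_zero,
      hMn'.eventually_ne one_ne_zero] with n hn hm hm'
    simp only [Function.comp_apply] at hm hm'
    have hn0 : (0 : ℝ) < n := by exact_mod_cast hn
    have e1 : R (n + 1) = R n * ((1 + (1 + a) * (n : ℝ)⁻¹) / (1 + (n : ℝ)⁻¹))
        * (1 + (n : ℝ)⁻¹) ^ (-a) := by
      simp only [hR, binomProd_succ]
      have : ((n + 1 : ℕ) : ℝ) = n * (1 + (n : ℝ)⁻¹) := by push_cast; field_simp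
      rw [this, Real.mul_rpow hn0.le (by positivity)]
      have : 1 + a / ((n : ℝ) + 1) = (1 + (1 + a) * (n : ℝ)⁻¹) / (1 + (n : ℝ)⁻¹) := by
        field_simp; ring
      rw [this]
      ring
    have e2 : (1 + (n : ℝ)⁻¹) ^ 2 + p₁ * (n : ℝ)⁻¹ * (1 + (n : ℝ)⁻¹) + p₂ * (n : ℝ)⁻¹ ^ 2
        = M ((n + 1 : ℕ) : ℝ)⁻¹ * (1 + (n : ℝ)⁻¹) ^ 2 := by
      simp only [hM]
      push_cast
      field_simp
    simp only [hφ]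
    rw [e1, e2]
    have : (1 + (n : ℝ)⁻¹) ≠ 0 := by positivity
    generalize (n : ℝ)⁻¹ = v at *
    generalize (1 + v) ^ (-a) = w at *
    generalize M v = m at *
    generalize M ((n + 1 : ℕ) : ℝ)⁻¹ = m' at *
    field_simp
    ring
  have h1 := (tendsto_sub_isBigO_pow_three hQ hd).mul (hMn.isBigO_one ℝ)
  simp only [mul_one, Function.comp_def] at h1
  refine h1.congr' ?_ (Eventually.of_forall fun _ => rfl)
  filter_upwards [hMn.eventually_ne one_ne_zero] with n hm
  simp only [Function.comp_apply] at hm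
  rw [sub_mul, div_mul_cancel₀ _ hm, one_mul]

/-! ### Moments of the Grünwald weights in closed form -/

lemma neg_one_pow_mul_fracBinom (α : ℝ) (k : ℕ) :
    (-1 : ℝ) ^ k * fracBinom α k = binomProd (-α - 1) k := by
  induction k with
  | zero => simp [fracBinom, binomProd_zero]
  | succ k ih =>
    rw [binomProd_succ, ← ih, fracBinom, fracBinom, prod_range_succ, Nat.factorial_succ, pow_succ]
    have : (k : ℝ) + 1 ≠ 0 := by positivity
    have := k.factorial_ne_zero
    push_cast
    field_simp
    ring

lemma abs_binomProd_le_one {α : ℝ} (hα0 : 0 < α) (hα1 : α < 1) (k : ℕ) :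
    |binomProd (-α - 1) k| ≤ 1 := by
  rw [binomProd, abs_prod]
  refine prod_le_one (fun _ _ => abs_nonneg _) fun i _ => ?_
  have hi : (0 : ℝ) ≤ i := i.cast_nonneg
  have e : 1 + (-α - 1) / ((i : ℝ) + 1) = (i - α) / (i + 1) := by
    field_simp; ring
  rw [e, abs_div, abs_of_pos (by positivity : (0 : ℝ) < i + 1), div_le_one (by positivity), abs_le]
  constructor <;> linarith

/-- Iterated Pascal rule: partial summation raises the parameter by one. -/
lemma sum_binomProd (a : ℝ) (m : ℕ) :
    ∑ k ∈ range (m + 1), binomProd a k = binomProd (a + 1) m := by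
  induction m with
  | zero => simp [binomProd_zero]
  | succ m ih => rw [sum_range_succ, ih, binomProd_add]

/-- If g is the backward difference of f, the moments of f are partial sums of those of g, and
partial summation raises the parameter. The condition at -1 kills the boundary term k = m + 1.
Applied to rising factorials, this yields each moment from the previous one. -/
lemma sum_mul_eq_binomProd_succ {W : ℕ → ℝ} {f g : ℝ → ℝ} {a : ℝ} (hf : f (-1) = 0)
    (hfg : ∀ x, f (x + 1) = f x + g (x + 1))
    (hg : ∀ m : ℕ, ∑ k ∈ range (m + 1), W k * g ((m : ℝ) - k) = binomProd a m) (m : ℕ) :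
    ∑ k ∈ range (m + 1), W k * f ((m : ℝ) - k) = binomProd (a + 1) m := by
  induction m with
  | zero =>
    have h0 := hg 0
    have h1 := hfg (-1)
    simp [binomProd_zero] at h0 ⊢
    simp [hf] at h1
    rw [h1, h0]
  | succ m ih =>
    rw [← binomProd_add, ← hg (m + 1), ← ih]
    have : ∀ k : ℕ, W k * f (((m + 1 : ℕ) : ℝ) - k)
        = W k * f ((m : ℝ) - k) + W k * g (((m + 1 : ℕ) : ℝ) - k) := by
      intro k
      rw [show ((m + 1 : ℕ) : ℝ) - k = ((m : ℝ) - k) + 1 by push_cast; ring, hfg]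
      ring
    simp_rw [this]
    rw [sum_add_distrib, sum_range_succ (fun k => W k * f ((m : ℝ) - k)) (m + 1)]
    have : (m : ℝ) - ((m + 1 : ℕ) : ℝ) = -1 := by push_cast; ring
    rw [this, hf]
    ring

lemma sum_weights_one (α : ℝ) (m : ℕ) :
    ∑ k ∈ range (m + 1), binomProd (-α - 1) k = binomProd (-α) m := by
  rw [sum_binomProd]; congr 1; ring

lemma sum_weights_linear (α : ℝ) (m : ℕ) :
    ∑ k ∈ range (m + 1), binomProd (-α - 1) k * ((m : ℝ) - k + 1) = binomProd (1 - α) m := by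
  have := sum_mul_eq_binomProd_succ (W := binomProd (-α - 1)) (f := fun x => x + 1)
    (g := fun _ => 1) (a := -α) (by norm_num) (fun x => by ring)
    (fun m => by simpa using sum_weights_one α m) m
  rw [this]; congr 1; ring

lemma sum_weights_quadratic (α : ℝ) (m : ℕ) :
    ∑ k ∈ range (m + 1), binomProd (-α - 1) k * (((m : ℝ) - k + 1) * ((m : ℝ) - k + 2) / 2)
      = binomProd (2 - α) m := by
  have := sum_mul_eq_binomProd_succ (W := binomProd (-α - 1))
    (f := fun x => (x + 1) * (x + 2) / 2) (g := fun x => x + 1) (a := 1 - α) (by norm_num)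
    (fun x => by ring) (sum_weights_linear α) m
  rw [this]; congr 1; ring

lemma sum_weights_cubic (α : ℝ) (m : ℕ) :
    ∑ k ∈ range (m + 1), binomProd (-α - 1) k *
        (((m : ℝ) - k + 1) * ((m : ℝ) - k + 2) * ((m : ℝ) - k + 3) / 6)
      = binomProd (3 - α) m := by
  have := sum_mul_eq_binomProd_succ (W := binomProd (-α - 1))
    (f := fun x => (x + 1) * (x + 2) * (x + 3) / 6) (g := fun x => (x + 1) * (x + 2) / 2)
    (a := 2 - α) (by norm_num) (fun x => by ring) (sum_weights_quadratic α) m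
  rw [this]; congr 1; ring

/-- The kernel `s_+^β / Γ(β + 1)` of the fractional integral of order `β + 1`. -/
noncomputable def powKer (β s : ℝ) : ℝ := (max s 0) ^ β / Real.Gamma (β + 1)

lemma powKer_of_nonneg {β s : ℝ} (hs : 0 ≤ s) : powKer β s = s ^ β / Real.Gamma (β + 1) := by
  rw [powKer, max_eq_left hs]

lemma powKer_of_nonpos {β s : ℝ} (hβ : β ≠ 0) (hs : s ≤ 0) : powKer β s = 0 := by
  rw [powKer, max_eq_right hs, Real.zero_rpow hβ, zero_div]

lemma continuous_powKer {β : ℝ} (hβ : 0 ≤ β) : Continuous (powKer β) := by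
  unfold powKer
  exact ((continuous_id.max continuous_const).rpow_const fun _ => Or.inr hβ).div_const _

lemma powKer_mul {β h : ℝ} (s : ℝ) (hh : 0 ≤ h) : powKer β (h * s) = h ^ β * powKer β s := by
  have : max (h * s) 0 = h * max s 0 := by
    rw [mul_max_of_nonneg _ _ hh, mul_zero]
  rw [powKer, powKer, this, Real.mul_rpow hh (le_max_right _ _)]
  ring

/-- With m = ⌊u⌋ and θ = u - m, the polynomial (x+θ)^2/2 at x = m-k is expanded in the basis
(x+1)(x+2)/2, x+1, 1, whose moments are known. The cubic version below is analogous. -/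
lemma sum_weights_powKer_two (α : ℝ) {u : ℝ} (hu : 0 ≤ u) :
    ∑ k ∈ range (⌊u⌋₊ + 1), binomProd (-α - 1) k * powKer 2 (u - k)
      = binomProd (2 - α) ⌊u⌋₊ + ((u - ⌊u⌋₊) - 3 / 2) * binomProd (1 - α) ⌊u⌋₊
        + (u - ⌊u⌋₊ - 1) ^ 2 / 2 * binomProd (-α) ⌊u⌋₊ := by
  rw [← sum_weights_quadratic, ← sum_weights_linear, ← sum_weights_one, mul_sum, mul_sum,
    ← sum_add_distrib, ← sum_add_distrib]
  refine sum_congr rfl fun k hk => ?_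
  have hk' : (k : ℝ) ≤ u :=
    le_trans (by exact_mod_cast (Nat.lt_succ_iff.1 (mem_range.1 hk))) (Nat.floor_le hu)
  rw [powKer_of_nonneg (by linarith)]
  have : Real.Gamma (2 + 1) = 2 := by
    simpa using Real.Gamma_nat_eq_factorial 2
  rw [this]
  norm_cast
  push_cast
  ring

lemma sum_weights_powKer_three (α : ℝ) {u : ℝ} (hu : 0 ≤ u) :
    ∑ k ∈ range (⌊u⌋₊ + 1), binomProd (-α - 1) k * powKer 3 (u - k)
      = binomProd (3 - α) ⌊u⌋₊ + ((u - ⌊u⌋₊) - 2) * binomProd (2 - α) ⌊u⌋₊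
        + ((u - ⌊u⌋₊) ^ 2 / 2 - 3 * (u - ⌊u⌋₊) / 2 + 7 / 6) * binomProd (1 - α) ⌊u⌋₊
        + (u - ⌊u⌋₊ - 1) ^ 3 / 6 * binomProd (-α) ⌊u⌋₊ := by
  rw [← sum_weights_cubic, ← sum_weights_quadratic, ← sum_weights_linear, ← sum_weights_one,
    mul_sum, mul_sum, mul_sum, ← sum_add_distrib, ← sum_add_distrib, ← sum_add_distrib]
  refine sum_congr rfl fun k hk => ?_
  have hk' : (k : ℝ) ≤ u :=
    le_trans (by exact_mod_cast (Nat.lt_succ_iff.1 (mem_range.1 hk))) (Nat.floor_le hu)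
  rw [powKer_of_nonneg (by linarith)]
  have : Real.Gamma (3 + 1) = 6 := by
    simpa [Nat.factorial] using Real.Gamma_nat_eq_factorial 3
  rw [this]
  norm_cast
  push_cast
  ring

/-! ### Expansions in powers of 1/⌊u⌋ with bounded fractional part -/

lemma tendsto_floor_inv : Tendsto (fun u : ℝ => (⌊u⌋₊ : ℝ)⁻¹) atTop (𝓝 0) :=
  tendsto_inv_atTop_nhds_zero_nat.comp tendsto_nat_floor_atTop

lemma frac_isBigO_one (c : ℝ) :
    (fun u : ℝ => u - ⌊u⌋₊ - c) =O[atTop] fun _ => (1 : ℝ) := by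
  refine IsBigO.of_bound (1 + |c|) ?_
  filter_upwards [eventually_ge_atTop 0] with u hu
  have h1 := Nat.floor_le hu
  have h2 := Nat.lt_floor_add_one u
  rw [norm_one, mul_one]
  refine (norm_sub_le _ _).trans (add_le_add ?_ le_rfl)
  rw [Real.norm_eq_abs, abs_le]
  constructor <;> linarith

lemma one_add_frac_rpow_isBigO (a c : ℝ) :
    (fun u : ℝ => (1 + (u - ⌊u⌋₊ - c) * (⌊u⌋₊ : ℝ)⁻¹) ^ a
      - (1 + a * ((u - ⌊u⌋₊ - c) * (⌊u⌋₊ : ℝ)⁻¹)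
        + a * (a - 1) / 2 * ((u - ⌊u⌋₊ - c) * (⌊u⌋₊ : ℝ)⁻¹) ^ 2)) =O[atTop]
      fun u => (⌊u⌋₊ : ℝ)⁻¹ ^ 3 := by
  have hd := (frac_isBigO_one c).mul (isBigO_refl (fun u : ℝ => (⌊u⌋₊ : ℝ)⁻¹) atTop)
  simp only [one_mul] at hd
  have h0 := hd.trans_tendsto tendsto_floor_inv
  have h1 : (fun v : ℝ => (1 + v) ^ a - (1 + a * v + a * (a - 1) / 2 * v ^ 2)) =O[𝓝 0]
      fun v => v ^ 3 := by
    have h2 : (fun v : ℝ => v ^ 4) =O[𝓝 0] fun v => v ^ 3 :=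
      IsBigO.of_bound 1 (by
        filter_upwards [Metric.ball_mem_nhds (0 : ℝ) one_pos] with v hv
        have : ‖v‖ ≤ 1 := by simpa using (mem_ball_zero_iff.1 hv).le
        rw [norm_pow, norm_pow, one_mul]
        exact pow_le_pow_of_le_one (norm_nonneg _) this (by norm_num))
    refine (((one_add_rpow_isBigO_four a).trans h2).add
      ((isBigO_refl (fun v : ℝ => v ^ 3) (𝓝 0)).const_mul_left (a * (a - 1) * (a - 2) / 6))).congr_left
      fun v => ?_
    ring
  exact (h1.comp_tendsto h0).trans (hd.pow 3)

lemma isBigO_pow_of_le {ι : Type*} {l : Filter ι} {v : ι → ℝ} (hv : Tendsto v l (𝓝 0)) {m n : ℕ}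
    (h : m ≤ n) : (fun i => v i ^ n) =O[l] fun i => v i ^ m := by
  refine IsBigO.of_bound 1 ?_
  filter_upwards [hv (Metric.ball_mem_nhds (0 : ℝ) one_pos)] with i hi
  have : ‖v i‖ ≤ 1 := (mem_ball_zero_iff.1 hi).le
  rw [norm_pow, norm_pow, one_mul]
  exact pow_le_pow_of_le_one (norm_nonneg _) this h

lemma floor_rpow_isBigO (α : ℝ) (hα : 0 < α) :
    (fun u : ℝ => (⌊u⌋₊ : ℝ) ^ (-α)) =O[atTop] fun u => u ^ (-α) := by
  refine IsBigO.of_bound (2 ^ α) ?_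
  filter_upwards [eventually_ge_atTop 2] with u hu
  have h2 := Nat.lt_floor_add_one u
  have h3 : u / 2 ≤ ⌊u⌋₊ := by linarith
  rw [Real.norm_of_nonneg (by positivity), Real.norm_of_nonneg (by positivity)]
  refine (Real.rpow_le_rpow_of_nonpos (by positivity) h3 (by linarith)).trans (le_of_eq ?_)
  rw [Real.div_rpow (by linarith) (by norm_num), Real.rpow_neg (by norm_num : (0:ℝ) ≤ 2)]
  field_simp

/-- Normalized form `Γ(a + 1) (⌊u⌋ + a choose ⌊u⌋) ⌊u⌋^{-a}` of the binomial coefficient. -/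
noncomputable def normBinom (a u : ℝ) : ℝ :=
  Real.Gamma (a + 1) * binomProd a ⌊u⌋₊ * (⌊u⌋₊ : ℝ) ^ (-a)

lemma normBinom_isBigO_three (a : ℝ) (ha : -1 < a) :
    (fun u => normBinom a u - (1 + a * (a + 1) / 2 * (⌊u⌋₊ : ℝ)⁻¹
      + a * (a - 1) * (a + 1) * (3 * a + 2) / 24 * (⌊u⌋₊ : ℝ)⁻¹ ^ 2)) =O[atTop]
      fun u => (⌊u⌋₊ : ℝ)⁻¹ ^ 3 :=
  (binomProd_isBigO a ha).comp_tendsto tendsto_nat_floor_atTop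

lemma normBinom_isBigO_two (a : ℝ) (ha : -1 < a) :
    (fun u => normBinom a u - (1 + a * (a + 1) / 2 * (⌊u⌋₊ : ℝ)⁻¹)) =O[atTop]
      fun u => (⌊u⌋₊ : ℝ)⁻¹ ^ 2 := by
  refine (((normBinom_isBigO_three a ha).trans
    (isBigO_pow_of_le tendsto_floor_inv (by norm_num : 2 ≤ 3))).add
    ((isBigO_refl (fun u : ℝ => (⌊u⌋₊ : ℝ)⁻¹ ^ 2) atTop).const_mul_left
      (a * (a - 1) * (a + 1) * (3 * a + 2) / 24))).congr_left fun u => ?_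
  ring

lemma normBinom_isBigO_one (a : ℝ) (ha : -1 < a) :
    (fun u => normBinom a u - 1) =O[atTop] fun u => (⌊u⌋₊ : ℝ)⁻¹ := by
  have h := isBigO_pow_of_le tendsto_floor_inv (by norm_num : 1 ≤ 2)
  simp only [pow_one] at h
  refine (((normBinom_isBigO_two a ha).trans h).add
    ((isBigO_refl (fun u : ℝ => (⌊u⌋₊ : ℝ)⁻¹) atTop).const_mul_left
      (a * (a + 1) / 2))).congr_left fun u => ?_
  ring

lemma normBinom_bounded (a : ℝ) (ha : -1 < a) :
    (normBinom a) =O[atTop] fun _ => (1 : ℝ) := by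
  have h := (tendsto_binomProd a ha).comp tendsto_nat_floor_atTop (α := ℝ)
  exact h.isBigO_one ℝ

lemma one_add_frac_rpow_isBigO_two (a c : ℝ) :
    (fun u : ℝ => (1 + (u - ⌊u⌋₊ - c) * (⌊u⌋₊ : ℝ)⁻¹) ^ a
      - (1 + a * ((u - ⌊u⌋₊ - c) * (⌊u⌋₊ : ℝ)⁻¹))) =O[atTop]
      fun u => (⌊u⌋₊ : ℝ)⁻¹ ^ 2 := by
  have hd := ((frac_isBigO_one c).mul (isBigO_refl (fun u : ℝ => (⌊u⌋₊ : ℝ)⁻¹) atTop)).pow 2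
  simp only [one_mul] at hd
  refine (((one_add_frac_rpow_isBigO a c).trans
    (isBigO_pow_of_le tendsto_floor_inv (by norm_num : 2 ≤ 3))).add
    (hd.const_mul_left (a * (a - 1) / 2))).congr_left fun u => ?_
  ring

lemma binomProd_eq_normBinom {a u : ℝ} (hu : 1 ≤ u) :
    Real.Gamma (a + 1) * binomProd a ⌊u⌋₊ = normBinom a u * (⌊u⌋₊ : ℝ) ^ a := by
  have h : (0 : ℝ) < ⌊u⌋₊ := by exact_mod_cast Nat.floor_pos.2 hu
  rw [normBinom, mul_assoc, ← Real.rpow_add h, neg_add_cancel, Real.rpow_zero, mul_one]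

lemma powKer_sub_eq {a u c : ℝ} (hu : 1 ≤ u) (hc : c ≤ u) :
    powKer a (u - c) = (1 + (u - ⌊u⌋₊ - c) * (⌊u⌋₊ : ℝ)⁻¹) ^ a * (⌊u⌋₊ : ℝ) ^ a
      / Real.Gamma (a + 1) := by
  have h : (0 : ℝ) < ⌊u⌋₊ := by exact_mod_cast Nat.floor_pos.2 hu
  have e : 1 + (u - ⌊u⌋₊ - c) * (⌊u⌋₊ : ℝ)⁻¹ = (u - c) * (⌊u⌋₊ : ℝ)⁻¹ := by
    field_simp
    ring
  rw [powKer_of_nonneg (by linarith), e, ← Real.mul_rpow _ h.le, mul_assoc,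
    inv_mul_cancel₀ h.ne', mul_one]
  exact mul_nonneg (by linarith) (by positivity)

/-! ### Decay of the Peano kernels -/

/-- After division by ⌊u⌋^(2-α) and multiplication by Γ(3-α), both sides are expansions in 1/⌊u⌋.
They agree at orders 0 and 1 for every fractional part, so the difference is of order ⌊u⌋^(-2)
⌊u⌋^(2-α). -/
lemma kernel_two_isBigO {α : ℝ} (hα0 : 0 < α) (hα1 : α < 1) (p : ℝ) :
    (fun u : ℝ => ∑ k ∈ range (⌊u⌋₊ + 1), binomProd (-α - 1) k * powKer 2 (u - k)
      - ((1 + p - α / 2) * powKer (2 - α) (u - p)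
        + (α / 2 - p) * powKer (2 - α) (u - (p + 1)))) =O[atTop] fun u => u ^ (-α) := by
  refine IsBigO.trans ?_ (floor_rpow_isBigO α hα0)
  have hv := isBigO_refl (fun u : ℝ => (⌊u⌋₊ : ℝ)⁻¹) atTop
  have hθ := frac_isBigO_one
  -- Only remainders are collected here; the `ring` closing the first goal below verifies that the
  -- main terms cancel. Lowering the parameter by one costs a factor 1/⌊u⌋, so each lower binomial
  -- coefficient needs one order less.
  have hE := ((((normBinom_isBigO_two (2 - α) (by linarith)).add
    ((((hθ (3 / 2)).mul hv).mul (normBinom_isBigO_one (1 - α) (by linarith))).const_mul_left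
      (2 - α) |>.congr_right fun u => (by ring : _ = (⌊u⌋₊ : ℝ)⁻¹ ^ 2))).add
    (((((hθ 1).pow 2).mul (hv.pow 2)).mul (normBinom_bounded (-α) (by linarith))).const_mul_left
      ((2 - α) * (1 - α) / 2) |>.congr_right fun u => (by ring : _ = (⌊u⌋₊ : ℝ)⁻¹ ^ 2))).sub
    ((one_add_frac_rpow_isBigO_two (2 - α) p).const_mul_left (1 + p - α / 2))).sub
    ((one_add_frac_rpow_isBigO_two (2 - α) (p + 1)).const_mul_left (α / 2 - p))
  have hE' := (hE.mul (isBigO_refl (fun u : ℝ => (⌊u⌋₊ : ℝ) ^ (2 - α)) atTop)).const_mul_left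
    (Real.Gamma (2 - α + 1))⁻¹
  refine hE'.congr' ?_ ?_
  · filter_upwards [eventually_ge_atTop 1, eventually_ge_atTop p, eventually_ge_atTop (p + 1)]
      with u hu hp hp1
    have h : (0 : ℝ) < ⌊u⌋₊ := by exact_mod_cast Nat.floor_pos.2 hu
    rw [sum_weights_powKer_two α (by linarith), powKer_sub_eq hu hp, powKer_sub_eq hu hp1]
    have hG : Real.Gamma (2 - α + 1) ≠ 0 := (Real.Gamma_pos_of_pos (by linarith)).ne'
    have g1 : Real.Gamma (2 - α + 1) = (2 - α) * Real.Gamma (1 - α + 1) := by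
      rw [show 1 - α + 1 = 2 - α by ring, Real.Gamma_add_one (by linarith)]
    have g0 : Real.Gamma (1 - α + 1) = (1 - α) * Real.Gamma (-α + 1) := by
      rw [show -α + 1 = 1 - α by ring, Real.Gamma_add_one (by linarith)]
    have b2 := binomProd_eq_normBinom (a := 2 - α) hu
    have b1 := binomProd_eq_normBinom (a := 1 - α) hu
    have b0 := binomProd_eq_normBinom (a := -α) hu
    have r1 : (⌊u⌋₊ : ℝ) ^ (1 - α) = (⌊u⌋₊ : ℝ) ^ (2 - α) * (⌊u⌋₊ : ℝ)⁻¹ := by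
      rw [← Real.rpow_neg_one, ← Real.rpow_add h]; congr 1; ring
    have r0 : (⌊u⌋₊ : ℝ) ^ (-α) = (⌊u⌋₊ : ℝ) ^ (2 - α) * (⌊u⌋₊ : ℝ)⁻¹ ^ 2 := by
      rw [← Real.rpow_natCast, Real.inv_rpow h.le, ← Real.rpow_neg h.le, ← Real.rpow_add h]
      congr 1; push_cast; ring
    rw [r1] at b1
    rw [r0] at b0
    have hdist : ∀ a b c x y β₀ β₁ : ℝ, Real.Gamma (2 - α + 1) *
        (a + b + c - (β₀ * (x / Real.Gamma (2 - α + 1)) + β₁ * (y / Real.Gamma (2 - α + 1))))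
        = Real.Gamma (2 - α + 1) * a + Real.Gamma (2 - α + 1) * b + Real.Gamma (2 - α + 1) * c
          - (β₀ * x + β₁ * y) := by
      intros; field_simp
    rw [inv_mul_eq_iff_eq_mul₀ hG, hdist, b2]
    have b1' : Real.Gamma (2 - α + 1) * ((u - ⌊u⌋₊ - 3 / 2) * binomProd (1 - α) ⌊u⌋₊)
        = (2 - α) * (u - ⌊u⌋₊ - 3 / 2) *
          (normBinom (1 - α) u * ((⌊u⌋₊ : ℝ) ^ (2 - α) * (⌊u⌋₊ : ℝ)⁻¹)) := by
      rw [← b1, g1]; ring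
    have b0' : Real.Gamma (2 - α + 1) * ((u - ⌊u⌋₊ - 1) ^ 2 / 2 * binomProd (-α) ⌊u⌋₊)
        = (2 - α) * (1 - α) * ((u - ⌊u⌋₊ - 1) ^ 2 / 2) *
          (normBinom (-α) u * ((⌊u⌋₊ : ℝ) ^ (2 - α) * (⌊u⌋₊ : ℝ)⁻¹ ^ 2)) := by
      rw [← b0, g1, g0]; ring
    rw [b1', b0']
    ring
  · filter_upwards [eventually_ge_atTop 1] with u hu
    have h : (0 : ℝ) < ⌊u⌋₊ := by exact_mod_cast Nat.floor_pos.2 hu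
    rw [← Real.rpow_natCast, Real.inv_rpow h.le, ← Real.rpow_neg h.le, ← Real.rpow_add h]
    congr 1; push_cast; ring

lemma kernel_three_isBigO {α : ℝ} (hα0 : 0 < α) (hα1 : α < 1) (p : ℝ) :
    (fun u : ℝ => ∑ k ∈ range (⌊u⌋₊ + 1), binomProd (-α - 1) k * powKer 3 (u - k)
      - ((1 + 3 * p / 2 + p ^ 2 / 2 - 17 * α / 24 - p * α / 2 + α ^ 2 / 8)
            * powKer (3 - α) (u - p)
        + (-2 * p - p ^ 2 + 11 * α / 12 + p * α - α ^ 2 / 4) * powKer (3 - α) (u - (p + 1))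
        + (p / 2 + p ^ 2 / 2 - 5 * α / 24 - p * α / 2 + α ^ 2 / 8)
            * powKer (3 - α) (u - (p + 2)))) =O[atTop] fun u => u ^ (-α) := by
  refine IsBigO.trans ?_ (floor_rpow_isBigO α hα0)
  have hv := isBigO_refl (fun u : ℝ => (⌊u⌋₊ : ℝ)⁻¹) atTop
  have hθ := frac_isBigO_one
  have hquad : (fun u : ℝ => (u - ⌊u⌋₊) ^ 2 / 2 - 3 * (u - ⌊u⌋₊) / 2 + 7 / 6) =O[atTop]
      fun _ => (1 : ℝ) := by
    refine (((((hθ 0).pow 2).const_mul_left (1 / 2)).sub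
      (((hθ 0).const_mul_left (3 / 2)).congr_right fun _ => by ring)).add
      (isBigO_const_const (7 / 6 : ℝ) (by norm_num : (1 : ℝ) ^ 2 ≠ 0) atTop)).congr
      (fun u => by ring) fun _ => by ring
  -- Same scheme one order further: orders 0, 1 and 2 now cancel in the final `ring` of the first
  -- goal.
  have hE := ((((((normBinom_isBigO_three (3 - α) (by linarith)).add
    ((((hθ 2).mul hv).mul (normBinom_isBigO_two (2 - α) (by linarith))).const_mul_left
      (3 - α) |>.congr_right fun u => (by ring : _ = (⌊u⌋₊ : ℝ)⁻¹ ^ 3))).add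
    (((hquad.mul (hv.pow 2)).mul (normBinom_isBigO_one (1 - α) (by linarith))).const_mul_left
      ((3 - α) * (2 - α)) |>.congr_right fun u => (by ring : _ = (⌊u⌋₊ : ℝ)⁻¹ ^ 3))).add
    (((((hθ 1).pow 3).mul (hv.pow 3)).mul (normBinom_bounded (-α) (by linarith))).const_mul_left
      ((3 - α) * (2 - α) * (1 - α) / 6) |>.congr_right
        fun u => (by ring : _ = (⌊u⌋₊ : ℝ)⁻¹ ^ 3))).sub
    ((one_add_frac_rpow_isBigO (3 - α) p).const_mul_left
      (1 + 3 * p / 2 + p ^ 2 / 2 - 17 * α / 24 - p * α / 2 + α ^ 2 / 8))).sub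
    ((one_add_frac_rpow_isBigO (3 - α) (p + 1)).const_mul_left
      (-2 * p - p ^ 2 + 11 * α / 12 + p * α - α ^ 2 / 4))).sub
    ((one_add_frac_rpow_isBigO (3 - α) (p + 2)).const_mul_left
      (p / 2 + p ^ 2 / 2 - 5 * α / 24 - p * α / 2 + α ^ 2 / 8))
  have hE' := (hE.mul (isBigO_refl (fun u : ℝ => (⌊u⌋₊ : ℝ) ^ (3 - α)) atTop)).const_mul_left
    (Real.Gamma (3 - α + 1))⁻¹
  refine hE'.congr' ?_ ?_
  · filter_upwards [eventually_ge_atTop 1, eventually_ge_atTop p, eventually_ge_atTop (p + 1),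
      eventually_ge_atTop (p + 2)] with u hu hp hp1 hp2
    have h : (0 : ℝ) < ⌊u⌋₊ := by exact_mod_cast Nat.floor_pos.2 hu
    rw [sum_weights_powKer_three α (by linarith), powKer_sub_eq hu hp, powKer_sub_eq hu hp1,
      powKer_sub_eq hu hp2]
    have hG : Real.Gamma (3 - α + 1) ≠ 0 := (Real.Gamma_pos_of_pos (by linarith)).ne'
    have g2 : Real.Gamma (3 - α + 1) = (3 - α) * Real.Gamma (2 - α + 1) := by
      rw [show 2 - α + 1 = 3 - α by ring, Real.Gamma_add_one (by linarith)]
    have g1 : Real.Gamma (2 - α + 1) = (2 - α) * Real.Gamma (1 - α + 1) := by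
      rw [show 1 - α + 1 = 2 - α by ring, Real.Gamma_add_one (by linarith)]
    have g0 : Real.Gamma (1 - α + 1) = (1 - α) * Real.Gamma (-α + 1) := by
      rw [show -α + 1 = 1 - α by ring, Real.Gamma_add_one (by linarith)]
    have b3 := binomProd_eq_normBinom (a := 3 - α) hu
    have b2 := binomProd_eq_normBinom (a := 2 - α) hu
    have b1 := binomProd_eq_normBinom (a := 1 - α) hu
    have b0 := binomProd_eq_normBinom (a := -α) hu
    have r2 : (⌊u⌋₊ : ℝ) ^ (2 - α) = (⌊u⌋₊ : ℝ) ^ (3 - α) * (⌊u⌋₊ : ℝ)⁻¹ := by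
      rw [← Real.rpow_neg_one, ← Real.rpow_add h]; congr 1; ring
    have r1 : (⌊u⌋₊ : ℝ) ^ (1 - α) = (⌊u⌋₊ : ℝ) ^ (3 - α) * (⌊u⌋₊ : ℝ)⁻¹ ^ 2 := by
      rw [← Real.rpow_natCast, Real.inv_rpow h.le, ← Real.rpow_neg h.le, ← Real.rpow_add h]
      congr 1; push_cast; ring
    have r0 : (⌊u⌋₊ : ℝ) ^ (-α) = (⌊u⌋₊ : ℝ) ^ (3 - α) * (⌊u⌋₊ : ℝ)⁻¹ ^ 3 := by
      rw [← Real.rpow_natCast, Real.inv_rpow h.le, ← Real.rpow_neg h.le, ← Real.rpow_add h]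
      congr 1; push_cast; ring
    rw [r2] at b2
    rw [r1] at b1
    rw [r0] at b0
    have hdist : ∀ a b c d x y z β₀ β₁ β₂ : ℝ, Real.Gamma (3 - α + 1) *
        (a + b + c + d - (β₀ * (x / Real.Gamma (3 - α + 1)) + β₁ * (y / Real.Gamma (3 - α + 1))
          + β₂ * (z / Real.Gamma (3 - α + 1))))
        = Real.Gamma (3 - α + 1) * a + Real.Gamma (3 - α + 1) * b + Real.Gamma (3 - α + 1) * c
          + Real.Gamma (3 - α + 1) * d - (β₀ * x + β₁ * y + β₂ * z) := by
      intros; field_simp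
    rw [inv_mul_eq_iff_eq_mul₀ hG, hdist, b3]
    have b2' : Real.Gamma (3 - α + 1) * ((u - ⌊u⌋₊ - 2) * binomProd (2 - α) ⌊u⌋₊)
        = (3 - α) * (u - ⌊u⌋₊ - 2) *
          (normBinom (2 - α) u * ((⌊u⌋₊ : ℝ) ^ (3 - α) * (⌊u⌋₊ : ℝ)⁻¹)) := by
      rw [← b2, g2]; ring
    have b1' : Real.Gamma (3 - α + 1) * (((u - ⌊u⌋₊) ^ 2 / 2 - 3 * (u - ⌊u⌋₊) / 2 + 7 / 6)
          * binomProd (1 - α) ⌊u⌋₊)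
        = (3 - α) * (2 - α) * ((u - ⌊u⌋₊) ^ 2 / 2 - 3 * (u - ⌊u⌋₊) / 2 + 7 / 6) *
          (normBinom (1 - α) u * ((⌊u⌋₊ : ℝ) ^ (3 - α) * (⌊u⌋₊ : ℝ)⁻¹ ^ 2)) := by
      rw [← b1, g2, g1]; ring
    have b0' : Real.Gamma (3 - α + 1) * ((u - ⌊u⌋₊ - 1) ^ 3 / 6 * binomProd (-α) ⌊u⌋₊)
        = (3 - α) * (2 - α) * (1 - α) * ((u - ⌊u⌋₊ - 1) ^ 3 / 6) *
          (normBinom (-α) u * ((⌊u⌋₊ : ℝ) ^ (3 - α) * (⌊u⌋₊ : ℝ)⁻¹ ^ 3)) := by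
      rw [← b0, g2, g1, g0]; ring
    rw [b2', b1', b0']
    ring
  · filter_upwards [eventually_ge_atTop 1] with u hu
    have h : (0 : ℝ) < ⌊u⌋₊ := by exact_mod_cast Nat.floor_pos.2 hu
    rw [← Real.rpow_natCast, Real.inv_rpow h.le, ← Real.rpow_neg h.le, ← Real.rpow_add h]
    congr 1; push_cast; ring

end

section

open Filter Asymptotics Topology Finset MeasureTheory intervalIntegral

/-! ### Kernel bound uniform in s and in the number of terms -/

lemma sum_powKer_eq_sum_range_floor {r u : ℝ} (hr : r ≠ 0) (W : ℕ → ℝ) {N : ℕ} (hN : u ≤ N) :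
    ∑ k ∈ range N, W k * powKer r (u - k)
      = ∑ k ∈ range (⌊u⌋₊ + 1), W k * powKer r (u - k) := by
  have hz : ∀ k : ℕ, u ≤ k → W k * powKer r (u - k) = 0 := fun k hk => by
    rw [powKer_of_nonpos hr (by linarith), mul_zero]
  have hfloor : u ≤ ((⌊u⌋₊ + 1 : ℕ) : ℝ) := by
    push_cast; exact (Nat.lt_floor_add_one u).le
  rcases le_total N (⌊u⌋₊ + 1) with h | h
  · exact sum_subset (range_mono h) fun k _ hk => hz k
      (hN.trans (by exact_mod_cast not_lt.1 (mt mem_range.2 hk)))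
  · exact (sum_subset (range_mono h) fun k _ hk => hz k
      (hfloor.trans (by exact_mod_cast not_lt.1 (mt mem_range.2 hk)))).symm

/-- Three regimes: the asymptotic bound for large s, vanishing of both sums for very negative s, and
compactness between, where S^α |s|^(-α) ≥ 1 turns a bounded quantity into the required form. The
point s = 0 is excluded because `0 ^ (-α)` evaluates to 0. -/
lemma exists_kernel_bound {α p r : ℝ} (hα0 : 0 < α) (hr : α < r) {q : ℕ} (β : Fin q → ℝ)
    (hO : (fun u : ℝ => ∑ k ∈ range (⌊u⌋₊ + 1), binomProd (-α - 1) k * powKer r (u - k)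
      - ∑ j, β j * powKer (r - α) (u - (p + (j : ℕ)))) =O[atTop] fun u => u ^ (-α)) :
    ∃ C, 0 ≤ C ∧ ∀ (N : ℕ) (s : ℝ), s + p ≤ N → s ≠ 0 →
      |∑ k ∈ range N, binomProd (-α - 1) k * powKer r (s + p - k)
        - ∑ j, β j * powKer (r - α) (s - (j : ℕ))| ≤ C * |s| ^ (-α) := by
  have hr0 : 0 < r := hα0.trans hr
  obtain ⟨c, hc0, hc⟩ := hO.exists_pos
  rw [IsBigOWith, eventually_atTop] at hc
  obtain ⟨U, hU⟩ := hc
  -- Beyond S one has s + p ≥ U and s + p ≥ s/2; below -S one has s + p < 0.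
  set S : ℝ := max (max (U - p) (2 * |p|)) 1 with hS
  have hS1 : 1 ≤ S := le_max_right _ _
  have hSU : U - p ≤ S := (le_max_left _ _).trans (le_max_left _ _)
  have hSp : 2 * |p| ≤ S := (le_max_right _ _).trans (le_max_left _ _)
  -- A fixed number of terms, enough for all s ≤ S, gives one continuous function to bound for every
  -- N.
  obtain ⟨N₀, hN₀⟩ := exists_nat_ge (S + p)
  have hcont : Continuous fun s : ℝ => ∑ k ∈ range N₀, binomProd (-α - 1) k * powKer r (s + p - k)
        - ∑ j, β j * powKer (r - α) (s - (j : ℕ)) := by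
    have h1 := continuous_powKer hr0.le
    have h2 := continuous_powKer (sub_pos.2 hr).le
    fun_prop
  obtain ⟨B, hB⟩ := (isCompact_Icc (a := -S) (b := S)).exists_bound_of_continuousOn
    hcont.continuousOn
  have hB0 : 0 ≤ B := (norm_nonneg _).trans (hB 0 ⟨by linarith, by linarith⟩)
  have hnn : 0 ≤ c * 2 ^ α + B * S ^ α := by positivity
  refine ⟨c * 2 ^ α + B * S ^ α, hnn, fun N s hN hs => ?_⟩
  have hs0 : 0 < |s| := abs_pos.2 hs
  have hsα : 0 ≤ |s| ^ (-α) := by positivity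
  rcases le_or_gt s S with h1 | h1
  · rcases lt_or_ge s (-S) with h2 | h2
    · have e1 : ∑ k ∈ range N, binomProd (-α - 1) k * powKer r (s + p - k) = 0 :=
        sum_eq_zero fun k _ => by
          have : (0 : ℝ) ≤ k := k.cast_nonneg
          rw [powKer_of_nonpos hr0.ne' (by linarith [le_abs_self p, abs_nonneg p]), mul_zero]
      have e2 : ∑ j, β j * powKer (r - α) (s - (j : ℕ)) = 0 :=
        sum_eq_zero fun j _ => by
          have : (0 : ℝ) ≤ (j : ℕ) := Nat.cast_nonneg _
          rw [powKer_of_nonpos (sub_pos.2 hr).ne' (by linarith), mul_zero]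
      rw [e1, e2, sub_zero, abs_zero]
      positivity
    · rw [sum_powKer_eq_sum_range_floor hr0.ne' _ hN,
        ← sum_powKer_eq_sum_range_floor hr0.ne' _ ((by linarith : s + p ≤ S + p).trans hN₀)]
      have h3 := hB s ⟨h2, h1⟩
      rw [Real.norm_eq_abs] at h3
      have h4 : 1 ≤ S ^ α * |s| ^ (-α) := by
        rw [Real.rpow_neg hs0.le, ← div_eq_mul_inv, one_le_div (by positivity)]
        exact Real.rpow_le_rpow hs0.le (abs_le.2 ⟨h2, h1⟩) hα0.le
      calc _ ≤ B := h3
        _ ≤ B * (S ^ α * |s| ^ (-α)) := le_mul_of_one_le_right hB0 h4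
        _ ≤ _ := by
          have : 0 ≤ c * 2 ^ α * |s| ^ (-α) := by positivity
          linarith
  · have hu := hU (s + p) (by linarith)
    have hs1 : 0 < s := by linarith
    have hhalf : s / 2 ≤ s + p := by linarith [neg_abs_le p]
    have e : ∀ j : Fin q, s + p - (p + ((j : ℕ) : ℝ)) = s - (j : ℕ) := fun j => by ring
    simp only [e] at hu
    rw [Real.norm_eq_abs, Real.norm_of_nonneg (Real.rpow_nonneg (by linarith) _)] at hu
    rw [sum_powKer_eq_sum_range_floor hr0.ne' _ hN, abs_of_pos hs1]
    have h4 : (s + p) ^ (-α) ≤ 2 ^ α * s ^ (-α) := by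
      refine (Real.rpow_le_rpow_of_nonpos (by positivity) hhalf (by linarith)).trans (le_of_eq ?_)
      rw [Real.div_rpow hs1.le (by norm_num), Real.rpow_neg (by norm_num : (0:ℝ) ≤ 2)]
      field_simp
    calc _ ≤ c * (s + p) ^ (-α) := hu
      _ ≤ c * (2 ^ α * s ^ (-α)) := mul_le_mul_of_nonneg_left h4 hc0.le
      _ ≤ _ := by
        have : 0 ≤ B * S ^ α * s ^ (-α) := by positivity
        linarith

/-! ### Integral representations of y and of its Caputo derivative -/

/-- The Riemann–Liouville fractional integral of order `γ + 1` with lower limit `b`. -/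
noncomputable def fracIntegral (b γ : ℝ) (f : ℝ → ℝ) (x : ℝ) : ℝ :=
  1 / Real.Gamma (γ + 1) * ∫ ξ in b..x, f ξ * (x - ξ) ^ γ

lemma intervalIntegrable_sub_rpow {γ : ℝ} (hγ : -1 < γ) (b x : ℝ) :
    IntervalIntegrable (fun ξ => (x - ξ) ^ γ) volume b x := by
  have := (intervalIntegrable_rpow' (a := x - b) (b := x - x) hγ).comp_sub_left x
  simpa using this

/-- Integration by parts. The boundary term at b vanishes since f does, the one at x because γ + 1 >
0. -/
lemma fracIntegral_eq_succ {b x γ : ℝ} (hbx : b ≤ x) (hγ : -1 < γ) {f f' : ℝ → ℝ}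
    (hf : ContinuousOn f (Set.Icc b x)) (hf' : ContinuousOn f' (Set.Icc b x))
    (hd : ∀ t ∈ Set.Ioo b x, HasDerivAt f (f' t) t) (h0 : f b = 0) :
    fracIntegral b γ f x = fracIntegral b (γ + 1) f' x := by
  have hg : 0 < γ + 1 := by linarith
  rw [← Set.uIcc_of_le hbx] at hf hf'
  have hv : ContinuousOn (fun ξ => -((x - ξ) ^ (γ + 1) / (γ + 1))) (Set.uIcc b x) := by
    have : Continuous fun ξ : ℝ => (x - ξ) ^ (γ + 1) :=
      (continuous_const.sub continuous_id).rpow_const fun _ => Or.inr hg.le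
    exact ((this.div_const _).neg).continuousOn
  have hvd : ∀ t ∈ Set.Ioo (min b x) (max b x),
      HasDerivAt (fun ξ => -((x - ξ) ^ (γ + 1) / (γ + 1))) ((x - t) ^ γ) t := by
    intro t ht
    rw [min_eq_left hbx, max_eq_right hbx] at ht
    have h1 := (((hasDerivAt_id t).const_sub x).rpow_const (p := γ + 1)
      (Or.inl (sub_pos.2 ht.2).ne')).div_const (γ + 1) |>.neg
    refine h1.congr_deriv ?_
    simp only [id, add_sub_cancel_right]
    field_simp
  have key := integral_mul_deriv_eq_deriv_mul_of_hasDerivAt hf hv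
    (by rwa [min_eq_left hbx, max_eq_right hbx]) hvd hf'.intervalIntegrable
    (intervalIntegrable_sub_rpow hγ b x)
  rw [fracIntegral, fracIntegral, key, h0, sub_self, Real.zero_rpow hg.ne',
    Real.Gamma_add_one hg.ne']
  have : ∀ t, f' t * -((x - t) ^ (γ + 1) / (γ + 1)) = -(1 / (γ + 1)) * (f' t * (x - t) ^ (γ + 1)) :=
    fun t => by ring
  simp_rw [this]
  rw [intervalIntegral.integral_const_mul]
  have := (Real.Gamma_pos_of_pos hg).ne'
  field_simp
  ring

lemma fracIntegral_eq_add {b X γ : ℝ} (hγ : -1 < γ) {g : ℕ → ℝ → ℝ} (r : ℕ)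
    (hg : ∀ i ≤ r + 1, ContinuousOn (g i) (Set.Icc b X))
    (hd : ∀ i ≤ r, ∀ t ∈ Set.Ioo b X, HasDerivAt (g i) (g (i + 1) t) t)
    (h0 : ∀ i ≤ r, g i b = 0) {x : ℝ} (hx : x ∈ Set.Icc b X) :
    fracIntegral b γ (g 1) x = fracIntegral b (γ + r) (g (r + 1)) x := by
  induction r with
  | zero => simp
  | succ r ih =>
    have hr : (0 : ℝ) ≤ r := r.cast_nonneg
    rw [ih (fun i hi => hg i (by omega)) (fun i hi => hd i (by omega)) fun i hi => h0 i (by omega),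
      fracIntegral_eq_succ hx.1 (by linarith)
        ((hg (r + 1) (by omega)).mono (Set.Icc_subset_Icc_right hx.2))
        ((hg (r + 1 + 1) (by omega)).mono (Set.Icc_subset_Icc_right hx.2))
        (fun t ht => hd (r + 1) le_rfl t ⟨ht.1, ht.2.trans_le hx.2⟩) (h0 (r + 1) le_rfl)]
    push_cast
    ring_nf

lemma integral_powKer_eq_zero {b X γ x : ℝ} (hγ : 0 < γ) (hbX : b ≤ X) (hx : x ≤ b)
    (f : ℝ → ℝ) : ∫ t in b..X, powKer γ (x - t) * f t = 0 := by
  rw [integral_congr (g := fun _ => 0), intervalIntegral.integral_zero]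
  intro t ht
  rw [Set.uIcc_of_le hbX] at ht
  simp only
  rw [powKer_of_nonpos hγ.ne' (by linarith [ht.1]), zero_mul]

lemma continuousOn_powKer_mul {b X γ x : ℝ} (hγ : 0 < γ) {f : ℝ → ℝ}
    (hf : ContinuousOn f (Set.Icc b X)) :
    ContinuousOn (fun t => powKer γ (x - t) * f t) (Set.Icc b X) :=
  (((continuous_powKer hγ.le).comp (continuous_const.sub continuous_id)).continuousOn).mul hf

/-- The truncated kernel vanishes past x, so the upper limit can be fixed at X. This lets values at
different nodes be combined under one integral. -/
lemma fracIntegral_eq_integral_powKer {b X γ x : ℝ} (hγ : 0 < γ) (hx : x ∈ Set.Icc b X)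
    {f : ℝ → ℝ} (hf : ContinuousOn f (Set.Icc b X)) :
    fracIntegral b γ f x = ∫ t in b..X, powKer γ (x - t) * f t := by
  have hc := continuousOn_powKer_mul (x := x) hγ hf
  rw [← integral_add_adjacent_intervals (b := x)
    ((hc.mono (Set.Icc_subset_Icc_right hx.2)).intervalIntegrable_of_Icc hx.1)
    ((hc.mono (Set.Icc_subset_Icc_left hx.1)).intervalIntegrable_of_Icc hx.2),
    integral_powKer_eq_zero hγ hx.2 le_rfl, add_zero, fracIntegral,
    ← intervalIntegral.integral_const_mul]
  refine integral_congr fun t ht => ?_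
  rw [Set.uIcc_of_le hx.1] at ht
  rw [powKer_of_nonneg (by linarith [ht.2])]
  ring

/-- The window [x-X, x-b] lies in [-(X-b), X-b], which makes the bound independent of x. -/
lemma integral_abs_sub_rpow_le {α b X x : ℝ} (hα1 : α < 1) (hx : x ∈ Set.Icc b X) :
    IntervalIntegrable (fun t => |x - t| ^ (-α)) volume b X ∧
    ∫ t in b..X, |x - t| ^ (-α) ≤ ∫ v in (-(X - b))..(X - b), |v| ^ (-α) := by
  have hpos : ∀ c : ℝ, 0 ≤ c → IntervalIntegrable (fun v : ℝ => |v| ^ (-α)) volume 0 c := by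
    intro c hc
    refine (intervalIntegrable_rpow' (a := 0) (b := c) (by linarith : -1 < -α)).congr ?_
    intro v hv
    rw [Set.uIoc_of_le hc] at hv
    simp only
    rw [abs_of_pos hv.1]
  have hL : 0 ≤ X - b := by linarith [hx.1, hx.2]
  have hneg : IntervalIntegrable (fun v : ℝ => |v| ^ (-α)) volume (-(X - b)) 0 := by
    have := (hpos _ hL).comp_sub_left 0
    simpa using this.symm
  have hint := hneg.trans (hpos _ hL)
  have hsub : IntervalIntegrable (fun v : ℝ => |v| ^ (-α)) volume (x - X) (x - b) := by
    refine hint.mono_set ?_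
    rw [Set.uIcc_of_le (by linarith), Set.uIcc_of_le (by linarith)]
    exact Set.Icc_subset_Icc (by linarith [hx.1]) (by linarith [hx.2])
  constructor
  · have := hsub.symm.comp_sub_left x
    simpa using this
  · rw [integral_comp_sub_left (fun v => |v| ^ (-α)) x]
    exact integral_mono_interval (by linarith [hx.1]) (by linarith [hx.1, hx.2])
      (by linarith [hx.2]) (Eventually.of_forall fun v => by positivity) hint

lemma hasDerivAt_iteratedDerivWithin_Icc {b X : ℝ} {y : ℝ → ℝ} {n : ℕ}
    (hy : ContDiffOn ℝ (n + 1 : ℕ) y (Set.Icc b X))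
    {t : ℝ} (ht : t ∈ Set.Ioo b X) :
    HasDerivAt (iteratedDerivWithin n y (Set.Icc b X))
      (iteratedDerivWithin (n + 1) y (Set.Icc b X) t) t := by
  have hu : UniqueDiffOn ℝ (Set.Icc b X) := uniqueDiffOn_Icc (ht.1.trans ht.2)
  have h1 := hy.differentiableOn_iteratedDerivWithin (m := n) (by exact_mod_cast n.lt_succ_self) hu
    t ⟨ht.1.le, ht.2.le⟩
  have h2 := h1.hasDerivWithinAt.hasDerivAt (Icc_mem_nhds ht.1 ht.2)
  rwa [← iteratedDerivWithin_succ] at h2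

lemma caputoDeriv_eq_fracIntegral {b X : ℝ} {y : ℝ → ℝ} {α : ℝ}
    (hy : ContDiffOn ℝ 1 y (Set.Icc b X)) {x : ℝ} (hx : x ∈ Set.Icc b X) :
    caputoDeriv α b y x = fracIntegral b (-α) (iteratedDerivWithin 1 y (Set.Icc b X)) x := by
  rw [caputoDeriv, fracIntegral, show -α + 1 = 1 - α by ring]
  congr 1
  -- Passing to the open interval is needed: at the endpoints `deriv y` may see values of y outside
  -- [b, X].
  rw [integral_of_le hx.1, integral_of_le hx.1, integral_Ioc_eq_integral_Ioo,
    integral_Ioc_eq_integral_Ioo]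
  refine setIntegral_congr_fun measurableSet_Ioo fun t ht => ?_
  have hd := hasDerivAt_iteratedDerivWithin_Icc (n := 0) (by simpa using hy)
    ⟨ht.1, ht.2.trans_le hx.2⟩
  rw [iteratedDerivWithin_zero] at hd
  rw [hd.deriv, Real.rpow_neg (by linarith [ht.2]), div_eq_mul_inv]

lemma eq_fracIntegral_zero {b X : ℝ} {y : ℝ → ℝ}
    (hy : ContDiffOn ℝ 1 y (Set.Icc b X)) (h0 : y b = 0) {x : ℝ}
    (hx : x ∈ Set.Icc b X) :
    y x = fracIntegral b 0 (iteratedDerivWithin 1 y (Set.Icc b X)) x := by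
  rcases hx.1.eq_or_lt with h | h
  · rw [← h, h0]; simp [fracIntegral]
  have hu : UniqueDiffOn ℝ (Set.Icc b X) := uniqueDiffOn_Icc (h.trans_le hx.2)
  have hc := hy.continuousOn_iteratedDerivWithin (m := 1) le_rfl hu
  have := integral_eq_sub_of_hasDerivAt_of_le hx.1
    (hy.continuousOn.mono (Set.Icc_subset_Icc_right hx.2))
    (fun t ht => by
      have hd := hasDerivAt_iteratedDerivWithin_Icc (n := 0) (by simpa using hy)
        ⟨ht.1, ht.2.trans_le hx.2⟩
      rwa [iteratedDerivWithin_zero] at hd)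
    ((hc.mono (Set.Icc_subset_Icc_right hx.2)).intervalIntegrable_of_Icc hx.1)
  rw [h0, sub_zero] at this
  rw [← this]
  simp [fracIntegral, -iteratedDerivWithin_one]

lemma fracIntegral_iteratedDerivWithin {b X : ℝ} {y : ℝ → ℝ} {r : ℕ} (hbX : b < X)
    (hy : ContDiffOn ℝ (r + 1 : ℕ) y (Set.Icc b X))
    (h0 : ∀ i ≤ r, iteratedDerivWithin i y (Set.Icc b X) b = 0)
    {γ : ℝ} (hγ : -1 < γ) {x : ℝ} (hx : x ∈ Set.Icc b X) :
    fracIntegral b γ (iteratedDerivWithin 1 y (Set.Icc b X)) x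
      = fracIntegral b (γ + r) (iteratedDerivWithin (r + 1) y (Set.Icc b X)) x :=
  fracIntegral_eq_add hγ (g := fun i => iteratedDerivWithin i y (Set.Icc b X)) r
    (fun i hi => hy.continuousOn_iteratedDerivWithin (by exact_mod_cast hi) (uniqueDiffOn_Icc hbX))
    (fun i hi t ht => hasDerivAt_iteratedDerivWithin_Icc
      (hy.of_le (by exact_mod_cast (by omega : i + 1 ≤ r + 1))) ht) h0 hx

lemma eq_fracIntegral_iteratedDerivWithin {b X : ℝ} {y : ℝ → ℝ} {r : ℕ} (hbX : b < X)
    (hy : ContDiffOn ℝ (r + 1 : ℕ) y (Set.Icc b X))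
    (h0 : ∀ i ≤ r, iteratedDerivWithin i y (Set.Icc b X) b = 0)
    {x : ℝ} (hx : x ∈ Set.Icc b X) :
    y x = fracIntegral b r (iteratedDerivWithin (r + 1) y (Set.Icc b X)) x := by
  have hy1 : ContDiffOn ℝ 1 y (Set.Icc b X) :=
    hy.of_le (by exact_mod_cast (by omega : 1 ≤ r + 1))
  rw [eq_fracIntegral_zero hy1 (by simpa using h0 0 (Nat.zero_le _)) hx,
    fracIntegral_iteratedDerivWithin hbX hy h0 (by norm_num) hx, zero_add]

/-- Left of b the truncated kernel vanishes, in agreement with the extension by zero, so one formula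
serves all sample points. -/
lemma zeroExtension_eq_integral_powKer {b X : ℝ} {y : ℝ → ℝ} {r : ℕ} (hbX : b < X)
    (hy : ContDiffOn ℝ (r + 1 : ℕ) y (Set.Icc b X))
    (h0 : ∀ i ≤ r, iteratedDerivWithin i y (Set.Icc b X) b = 0)
    (hr : 0 < r) {x : ℝ} (hx : x ≤ X) :
    zeroExtension b X y x
      = ∫ t in b..X, powKer r (x - t) * iteratedDerivWithin (r + 1) y (Set.Icc b X) t := by
  have hr' : (0 : ℝ) < r := by exact_mod_cast hr
  rcases le_or_gt b x with hb | hb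
  · rw [zeroExtension, Set.indicator_of_mem (show x ∈ Set.Icc b X from ⟨hb, hx⟩),
      eq_fracIntegral_iteratedDerivWithin hbX hy h0 ⟨hb, hx⟩,
      fracIntegral_eq_integral_powKer hr' ⟨hb, hx⟩
        (hy.continuousOn_iteratedDerivWithin le_rfl (uniqueDiffOn_Icc hbX))]
  · rw [zeroExtension, Set.indicator_of_notMem (fun h : x ∈ Set.Icc b X => absurd h.1 (not_le.2 hb)),
      integral_powKer_eq_zero hr' hbX.le hb.le]

lemma caputoDeriv_eq_integral_powKer {b X : ℝ} {y : ℝ → ℝ} {r : ℕ} (hbX : b < X)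
    (hy : ContDiffOn ℝ (r + 1 : ℕ) y (Set.Icc b X))
    (h0 : ∀ i ≤ r, iteratedDerivWithin i y (Set.Icc b X) b = 0)
    {α : ℝ} (hα1 : α < 1) (hr : 0 < r) {x : ℝ}
    (hx : x ∈ Set.Icc b X) :
    caputoDeriv α b y x
      = ∫ t in b..X, powKer (r - α) (x - t) * iteratedDerivWithin (r + 1) y (Set.Icc b X) t := by
  have hr' : (1 : ℝ) ≤ r := by exact_mod_cast hr
  rw [caputoDeriv_eq_fracIntegral (hy.of_le (by exact_mod_cast (by omega : 1 ≤ r + 1))) hx,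
    fracIntegral_iteratedDerivWithin hbX hy h0 (by linarith) hx, neg_add_eq_sub,
    fracIntegral_eq_integral_powKer (by linarith) hx
      (hy.continuousOn_iteratedDerivWithin le_rfl (uniqueDiffOn_Icc hbX))]

lemma abs_zeroExtension_le {b X : ℝ} {y : ℝ → ℝ} {r : ℕ} (hbX : b < X)
    (hy : ContDiffOn ℝ (r + 1 : ℕ) y (Set.Icc b X))
    (h0 : ∀ i ≤ r, iteratedDerivWithin i y (Set.Icc b X) b = 0)
    {G : ℝ}
    (hG : ∀ t ∈ Set.Icc b X, |iteratedDerivWithin (r + 1) y (Set.Icc b X) t| ≤ G) {x d : ℝ}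
    (hd : 0 ≤ d) (hx : x ≤ X) (hxd : x - b ≤ d) :
    |zeroExtension b X y x| ≤ 1 / Real.Gamma (r + 1) * (G * d ^ (r + 1)) := by
  have hΓ : 0 < Real.Gamma (r + 1) := Real.Gamma_pos_of_pos (by positivity)
  have hG0 : 0 ≤ G := (abs_nonneg _).trans (hG b ⟨le_rfl, hbX.le⟩)
  rcases le_or_gt b x with hb | hb
  · rw [zeroExtension, Set.indicator_of_mem (show x ∈ Set.Icc b X from ⟨hb, hx⟩),
      eq_fracIntegral_iteratedDerivWithin hbX hy h0 ⟨hb, hx⟩, fracIntegral, abs_mul,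
      abs_of_pos (one_div_pos.2 hΓ)]
    refine mul_le_mul_of_nonneg_left ?_ (by positivity)
    have := norm_integral_le_of_norm_le_const (a := b) (b := x) (C := G * d ^ r)
      (f := fun ξ => iteratedDerivWithin (r + 1) y (Set.Icc b X) ξ * (x - ξ) ^ (r : ℝ)) ?_
    · rw [Real.norm_eq_abs, abs_of_nonneg (by linarith : 0 ≤ x - b)] at this
      calc _ ≤ G * d ^ r * (x - b) := this
        _ ≤ G * d ^ r * d := mul_le_mul_of_nonneg_left hxd (by positivity)
        _ = _ := by ring
    · intro t ht
      rw [Set.uIoc_of_le hb] at ht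
      rw [norm_mul, Real.rpow_natCast, norm_pow, Real.norm_eq_abs, Real.norm_eq_abs,
        abs_of_nonneg (by linarith [ht.2] : 0 ≤ x - t)]
      exact mul_le_mul (hG t ⟨ht.1.le, ht.2.trans hx⟩)
        (pow_le_pow_left₀ (by linarith [ht.2]) (by linarith [ht.1]) r)
        (by have := ht.2; exact pow_nonneg (by linarith) _) hG0
  · rw [zeroExtension, Set.indicator_of_notMem (fun h : x ∈ Set.Icc b X => absurd h.1 (not_le.2 hb)), abs_zero]
    positivity

/-! ### Error estimate for the shifted Grünwald operator -/

/-- Scaling closes the estimate: h^(r-α) (|x-t|/h)^(-α) = h^r |x-t|^(-α). The condition on q and n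
keeps all nodes n - j at or to the right of b. -/
lemma exists_shiftedGrunwald_error_bound {b X : ℝ} {y : ℝ → ℝ} {r : ℕ} (hbX : b < X)
    (hy : ContDiffOn ℝ (r + 1 : ℕ) y (Set.Icc b X))
    (h0 : ∀ i ≤ r, iteratedDerivWithin i y (Set.Icc b X) b = 0)
    {α p : ℝ} (hα0 : 0 < α) (hα1 : α < 1) (hr : 0 < r)
    {q : ℕ} (β : Fin q → ℝ)
    (hO : (fun u : ℝ => ∑ k ∈ range (⌊u⌋₊ + 1), binomProd (-α - 1) k * powKer r (u - k)
      - ∑ j, β j * powKer (r - α) (u - (p + (j : ℕ)))) =O[atTop] fun u => u ^ (-α)) :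
    ∃ C : ℝ, ∀ (h : ℝ) (n : ℤ), 0 < h → 1 ≤ n → (q : ℤ) ≤ n + 1 →
        gridNode b h n ≤ X → gridNode b h n + p * h ≤ X →
        |h ^ (-α) * shiftedGrunwald α p b h (zeroExtension b X y) (gridNode b h n)
            - ∑ j : Fin q, β j * caputoDeriv α b y (gridNode b h (n - (j : ℕ)))| ≤ C * h ^ r := by
  have hr1 : (1 : ℝ) ≤ r := by exact_mod_cast hr
  obtain ⟨K, hK0, hK⟩ := exists_kernel_bound hα0 (by linarith : α < r) β hO
  set g := iteratedDerivWithin (r + 1) y (Set.Icc b X) with hg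
  have hgc : ContinuousOn g (Set.Icc b X) :=
    hy.continuousOn_iteratedDerivWithin le_rfl (uniqueDiffOn_Icc hbX)
  obtain ⟨G, hG⟩ := isCompact_Icc.exists_bound_of_continuousOn hgc
  simp only [Real.norm_eq_abs] at hG
  have hG0 : 0 ≤ G := (abs_nonneg _).trans (hG b ⟨le_rfl, hbX.le⟩)
  have hΓ : 0 < Real.Gamma (r + 1) := Real.Gamma_pos_of_pos (by positivity)
  set I := ∫ v in (-(X - b))..(X - b), |v| ^ (-α)
  set P : ℕ := ⌈|p|⌉₊
  refine ⟨K * G * I + P * (1 / Real.Gamma (r + 1) * (G * |p| ^ (r + 1))) * (X - b) ^ (1 - α),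
    fun h n hh hn hqn hX hpX => ?_⟩
  lift n to ℕ using (by omega) with m
  set x := gridNode b h (m : ℤ) with hx
  have hxe : x = b + m * h := by simp [hx, gridNode]
  have hm1 : (1 : ℝ) ≤ m := by exact_mod_cast hn
  have hmh : h ≤ m * h := le_mul_of_one_le_left hh.le hm1
  have hxI : x ∈ Set.Icc b X := ⟨by nlinarith, hX⟩
  have hhX : h ≤ X - b := by linarith
  -- For t ≥ b one has (x-t)/h + p ≤ m + |p|, so N terms meet the hypothesis of the kernel bound.
  set N := m + 1 + P with hN
  have hpP : |p| ≤ P := Nat.le_ceil _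
  have hfl : ⌊(x - b) / h⌋₊ = m := by
    rw [hxe, add_sub_cancel_left, mul_div_cancel_right₀ _ hh.ne', Nat.floor_natCast]
  set z := zeroExtension b X y with hz
  have hle : ∀ k : ℕ, x - ((k : ℝ) - p) * h ≤ X := fun k => by
    have : 0 ≤ (k : ℝ) * h := by positivity
    linarith
  -- the full Grünwald sum, expressed through the kernel
  have hrep : h ^ (-α) * ∑ k ∈ range N, binomProd (-α - 1) k * z (x - ((k : ℝ) - p) * h)
      - ∑ j : Fin q, β j * caputoDeriv α b y (gridNode b h ((m : ℤ) - (j : ℕ)))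
      = ∫ t in b..X, h ^ ((r : ℝ) - α) *
        (∑ k ∈ range N, binomProd (-α - 1) k * powKer r ((x - t) / h + p - k)
          - ∑ j, β j * powKer (r - α) ((x - t) / h - (j : ℕ))) * g t := by
    have hnode : ∀ j : Fin q, gridNode b h ((m : ℤ) - (j : ℕ)) = x - (j : ℕ) * h := fun j => by
      rw [hxe, gridNode]; push_cast; ring
    have hmem : ∀ j : Fin q, x - (j : ℕ) * h ∈ Set.Icc b X := fun j => by
      have hj : ((j : ℕ) : ℝ) ≤ m := by exact_mod_cast (by have := j.2; omega : (j : ℕ) ≤ m)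
      have := mul_le_mul_of_nonneg_right hj hh.le
      have h2 : 0 ≤ ((j : ℕ) : ℝ) * h := by positivity
      exact ⟨by linarith, by linarith⟩
    have hint1 : ∀ k ∈ range N, IntervalIntegrable
        (fun t => h ^ (-α) * (binomProd (-α - 1) k * (powKer r (x - ((k : ℝ) - p) * h - t) * g t)))
        volume b X := fun k _ =>
      (((continuousOn_powKer_mul (by linarith) hgc).intervalIntegrable_of_Icc hbX.le).const_mul
        _).const_mul _
    have hint2 : ∀ j ∈ (univ : Finset (Fin q)), IntervalIntegrable
        (fun t => β j * (powKer (r - α) (x - (j : ℕ) * h - t) * g t)) volume b X := fun j _ =>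
      ((continuousOn_powKer_mul (by linarith) hgc).intervalIntegrable_of_Icc hbX.le).const_mul _
    rw [mul_sum]
    simp_rw [hnode, fun j => caputoDeriv_eq_integral_powKer hbX hy h0 hα1 hr (hmem j), hz,
      fun k => zeroExtension_eq_integral_powKer hbX hy h0 hr (hle k), ← hg,
      ← intervalIntegral.integral_const_mul]
    rw [← integral_finsetSum hint1, ← integral_finsetSum hint2,
      ← integral_sub (by simpa only [Finset.sum_fn] using IntervalIntegrable.sum _ hint1)
        (by simpa only [Finset.sum_fn] using IntervalIntegrable.sum _ hint2)]
    refine integral_congr fun t _ => ?_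
    rw [mul_sub, sub_mul, mul_sum, mul_sum, sum_mul, sum_mul]
    have hs : h * ((x - t) / h) = x - t := mul_div_cancel₀ _ hh.ne'
    have hpow : h ^ ((r : ℝ) - α) = h ^ (-α) * h ^ (r : ℝ) := by
      rw [← Real.rpow_add hh]; congr 1; ring
    congr 1
    · refine sum_congr rfl fun k _ => ?_
      rw [show x - ((k : ℝ) - p) * h - t = h * ((x - t) / h + p - k) by
        rw [mul_sub, mul_add, hs]; ring, powKer_mul _ hh.le, hpow]
      ring
    · refine sum_congr rfl fun j _ => ?_
      rw [show x - (j : ℕ) * h - t = h * ((x - t) / h - (j : ℕ)) by rw [mul_sub, hs]; ring,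
        powKer_mul _ hh.le]
      ring
  have hfull : |h ^ (-α) * ∑ k ∈ range N, binomProd (-α - 1) k * z (x - ((k : ℝ) - p) * h)
      - ∑ j : Fin q, β j * caputoDeriv α b y (gridNode b h ((m : ℤ) - (j : ℕ)))|
      ≤ K * G * I * h ^ r := by
    rw [hrep, ← Real.norm_eq_abs]
    obtain ⟨hi, hiI⟩ := integral_abs_sub_rpow_le hα1 hxI
    -- The kernel bound is unavailable at s = 0, that is at t = x, a null set.
    have hae : ∀ᵐ t ∂volume, t ≠ x := by simp [ae_iff]
    refine (norm_integral_le_of_norm_le hbX.le (g := fun t => K * G * h ^ r * |x - t| ^ (-α)) ?_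
      (hi.const_mul _)).trans ?_
    · filter_upwards [hae] with t ht htI
      have hne : (x - t) / h ≠ 0 := div_ne_zero (sub_ne_zero.2 ht.symm) hh.ne'
      have hsN : (x - t) / h + p ≤ N := by
        have : (x - t) / h ≤ m := by
          rw [div_le_iff₀ hh]; linarith [htI.1]
        have := le_abs_self p
        rw [hN]; push_cast; linarith
      have hb := hK N _ hsN hne
      rw [norm_mul, norm_mul, Real.norm_eq_abs, Real.norm_eq_abs, Real.norm_eq_abs,
        abs_of_pos (Real.rpow_pos_of_pos hh _)]
      calc _ ≤ h ^ ((r : ℝ) - α) * (K * |(x - t) / h| ^ (-α)) * G := by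
            gcongr
            exact hG t ⟨htI.1.le, htI.2⟩
        _ = _ := by
            rw [abs_div, abs_of_pos hh, Real.div_rpow (abs_nonneg _) hh.le,
              Real.rpow_neg hh.le, Real.rpow_sub hh, Real.rpow_natCast]
            have := (Real.rpow_pos_of_pos hh α).ne'
            field_simp
    · rw [intervalIntegral.integral_const_mul]
      calc _ ≤ K * G * h ^ r * I := mul_le_mul_of_nonneg_left hiI (by positivity)
        _ = _ := by ring
  -- the terms between the truncation index and the full sum
  have htail : |h ^ (-α) * ∑ k ∈ Ico (m + 1) N, binomProd (-α - 1) k * z (x - ((k : ℝ) - p) * h)|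
      ≤ P * (1 / Real.Gamma (r + 1) * (G * |p| ^ (r + 1))) * (X - b) ^ (1 - α) * h ^ r := by
    -- These sample points lie at most |p|h to the right of b, where y is of order h^(r+1). The
    -- surplus h^(1-α) is absorbed using h ≤ X - b.
    have hterm : ∀ k ∈ Ico (m + 1) N, |binomProd (-α - 1) k * z (x - ((k : ℝ) - p) * h)|
        ≤ 1 / Real.Gamma (r + 1) * (G * (|p| * h) ^ (r + 1)) := by
      intro k hk
      have hk' : (m : ℝ) ≤ k := by exact_mod_cast (by have := mem_Ico.1 hk; omega : m ≤ k)
      rw [abs_mul]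
      refine (mul_le_of_le_one_left (abs_nonneg _) (abs_binomProd_le_one hα0 hα1 k)).trans
        (abs_zeroExtension_le hbX hy h0 hG (by positivity) (hle k) ?_)
      have h1 := mul_le_mul_of_nonneg_right hk' hh.le
      have h2 := mul_le_mul_of_nonneg_right (le_abs_self p) hh.le
      linarith
    have hsum := (abs_sum_le_sum_abs _ _).trans (sum_le_card_nsmul _ _ _ hterm)
    rw [Nat.card_Ico, hN, Nat.add_sub_cancel_left, nsmul_eq_mul] at hsum
    rw [abs_mul, abs_of_pos (Real.rpow_pos_of_pos hh _)]
    have hpw : h ^ (-α) * h = h ^ (1 - α) := by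
      rw [← Real.rpow_add_one hh.ne']; congr 1; ring
    calc _ ≤ h ^ (-α) * (P * (1 / Real.Gamma (r + 1) * (G * (|p| * h) ^ (r + 1)))) :=
          mul_le_mul_of_nonneg_left hsum (by positivity)
      _ = P * (1 / Real.Gamma (r + 1) * (G * |p| ^ (r + 1))) * h ^ (1 - α) * h ^ r := by
          rw [← hpw, mul_pow, pow_succ h r]; ring
      _ ≤ _ := by
          have := Real.rpow_le_rpow hh.le hhX (by linarith : 0 ≤ 1 - α)
          gcongr
  have hsplit : shiftedGrunwald α p b h z x
      = ∑ k ∈ range N, binomProd (-α - 1) k * z (x - ((k : ℝ) - p) * h)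
        - ∑ k ∈ Ico (m + 1) N, binomProd (-α - 1) k * z (x - ((k : ℝ) - p) * h) := by
    rw [shiftedGrunwald, hfl, eq_sub_iff_add_eq]
    simp_rw [neg_one_pow_mul_fracBinom]
    exact sum_range_add_sum_Ico _ (by omega)
  rw [hsplit, mul_sub, sub_right_comm, add_mul]
  exact (abs_sub _ _).trans (add_le_add hfull htail)

end

theorem lemma4 (α p b X : ℝ) (hα0 : 0 < α) (hα1 : α < 1) (hbX : b < X) (y : ℝ → ℝ) :
    -- part (i)
    ((ContDiffOn ℝ 4 y (Set.Icc b X) ∧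
        y b = 0 ∧
        iteratedDerivWithin 1 y (Set.Icc b X) b = 0 ∧
        iteratedDerivWithin 2 y (Set.Icc b X) b = 0) →
      ∃ C : ℝ, ∀ (h : ℝ) (n : ℤ), 0 < h → 1 ≤ n →
        gridNode b h n ≤ X → gridNode b h n + p * h ≤ X →
        |h ^ (-α) * shiftedGrunwald α p b h (zeroExtension b X y) (gridNode b h n)
            - ((α / 2 - p) * caputoDeriv α b y (gridNode b h (n - 1))
              + (1 + p - α / 2) * caputoDeriv α b y (gridNode b h n))| ≤ C * h ^ 2) ∧
    -- part (ii)
    ((ContDiffOn ℝ 5 y (Set.Icc b X) ∧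
        y b = 0 ∧
        iteratedDerivWithin 1 y (Set.Icc b X) b = 0 ∧
        iteratedDerivWithin 2 y (Set.Icc b X) b = 0 ∧
        iteratedDerivWithin 3 y (Set.Icc b X) b = 0) →
      ∃ C : ℝ, ∀ (h : ℝ) (n : ℤ), 0 < h → 2 ≤ n →
        gridNode b h n ≤ X → gridNode b h n + p * h ≤ X →
        |h ^ (-α) * shiftedGrunwald α p b h (zeroExtension b X y) (gridNode b h n)
            - ((p / 2 + p ^ 2 / 2 - 5 * α / 24 - p * α / 2 + α ^ 2 / 8)
                  * caputoDeriv α b y (gridNode b h (n - 2))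
              + (-2 * p - p ^ 2 + 11 * α / 12 + p * α - α ^ 2 / 4)
                  * caputoDeriv α b y (gridNode b h (n - 1))
              + (1 + 3 * p / 2 + p ^ 2 / 2 - 17 * α / 24 - p * α / 2 + α ^ 2 / 8)
                  * caputoDeriv α b y (gridNode b h n))| ≤ C * h ^ 3) := by
  constructor
  · rintro ⟨hy, y0, y1, y2⟩
    have hy' : ContDiffOn ℝ (2 + 1 : ℕ) y (Set.Icc b X) := hy.of_le (by norm_cast)
    have hz : ∀ i ≤ 2, iteratedDerivWithin i y (Set.Icc b X) b = 0 := by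
      intro i hi
      interval_cases i
      exacts [by simpa using y0, y1, y2]
    have hO := kernel_two_isBigO hα0 hα1 p
    -- Entry j of the coefficient vector belongs to the node n - j, so the order is the reverse of
    -- the one in the statement.
    obtain ⟨C, hC⟩ := exists_shiftedGrunwald_error_bound hbX hy' hz (α := α) (p := p) hα0 hα1
      two_pos ![1 + p - α / 2, α / 2 - p] (by simpa [Fin.sum_univ_two] using hO)
    refine ⟨C, fun h n hh hn hX hpX => ?_⟩
    have := hC h n hh hn (by push_cast; omega) hX hpX
    simpa [Fin.sum_univ_two, add_comm] using this
  · rintro ⟨hy, y0, y1, y2, y3⟩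
    have hy' : ContDiffOn ℝ (3 + 1 : ℕ) y (Set.Icc b X) := hy.of_le (by norm_cast)
    have hz : ∀ i ≤ 3, iteratedDerivWithin i y (Set.Icc b X) b = 0 := by
      intro i hi
      interval_cases i
      exacts [by simpa using y0, y1, y2, y3]
    have hO := kernel_three_isBigO hα0 hα1 p
    obtain ⟨C, hC⟩ := exists_shiftedGrunwald_error_bound hbX hy' hz (α := α) (p := p) hα0 hα1
      three_pos ![1 + 3 * p / 2 + p ^ 2 / 2 - 17 * α / 24 - p * α / 2 + α ^ 2 / 8,
        -2 * p - p ^ 2 + 11 * α / 12 + p * α - α ^ 2 / 4,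
        p / 2 + p ^ 2 / 2 - 5 * α / 24 - p * α / 2 + α ^ 2 / 8]
      (by simpa [Fin.sum_univ_three] using hO)
    refine ⟨C, fun h n hh hn hX hpX => (le_of_eq ?_).trans
      (hC h n hh (by omega) (by push_cast; omega) hX hpX)⟩
    simp [Fin.sum_univ_three]
    congr 1
    ring
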